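/- For integers $\alpha_1,\dots,\alpha_d\ge 2$ let $T(\alpha_1,\dots,\alpha_d)$ denote the symmetric tridiagonal $d\times d$ matrix with diagonal entries $\alpha_1,\dots,\alpha_d$ and with all entries on the sub- and superdiagonal equal to $1$. A Euclidean lattice is said to be of type T if it has a $\mathbb Z$-basis whose Gram matrix is $T(\alpha_1,\dots,\alpha_d)$ for some $d$ and some integers $\alpha_1,\dots,\alpha_d\geq 2$. The determinant of a lattice is the determinant of the Gram matrix of a $\mathbb Z$-basis, the norm of a lattice vector $x$ is its scalar product $\langle x,x\rangle$ with itself, and two lattices are isomorphic if there is a group isomorphism between them that preserves scalar products. Let $N\ge 2$ be an integer. Then the number of isomorphism classes of Euclidean lattices (of arbitrary dimension) that are of type T, have determinant $N$ and contain no element of norm $1$ is $$\frac{\Phi(N)+\nu_N}{2},$$ where $\Phi(N)=N\prod_{p\mid N}\left(1-\frac1p\right)$ is Euler's totient function and $\nu_N$ is the number of elements of order $\le 2$ in the multiplicative group $(\mathbb Z/N\mathbb Z)^*$. -/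

import Mathlib

/-- The symmetric tridiagonal matrix `T(α₁, …, αₙ)`: diagonal entries `α₁, …, αₙ`, and all entries
on the sub- and superdiagonal equal to `1`. -/
def tridiagonal {R : Type*} [CommRing R] {n : ℕ} (α : Fin n → R) : Matrix (Fin n) (Fin n) R :=
  Matrix.of fun i j =>
    if i = j then α i
    else if (i : ℕ) + 1 = (j : ℕ) ∨ (j : ℕ) + 1 = (i : ℕ) then 1
    else 0

/-- A Euclidean lattice (of arbitrary dimension): a discrete subgroup spanning the standard
Euclidean space `ℝ ^ dim`. -/
structure EuclideanLattice where
  /-- the dimension -/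
  dim : ℕ
  /-- the underlying subgroup of `ℝ ^ dim` -/
  carrier : Submodule ℤ (EuclideanSpace ℝ (Fin dim))
  [discrete : DiscreteTopology carrier]
  [isZLattice : IsZLattice ℝ carrier]

namespace EuclideanLattice

attribute [instance] EuclideanLattice.discrete EuclideanLattice.isZLattice

/-- Two Euclidean lattices are isomorphic if there is an isomorphism of groups between them
that preserves scalar products. -/
def Iso (L M : EuclideanLattice) : Prop :=
  ∃ e : L.carrier ≃ₗ[ℤ] M.carrier, ∀ x y : L.carrier,
    inner ℝ (e x : EuclideanSpace ℝ (Fin M.dim)) (e y : EuclideanSpace ℝ (Fin M.dim)) =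
      inner ℝ (x : EuclideanSpace ℝ (Fin L.dim)) (y : EuclideanSpace ℝ (Fin L.dim))

theorem iso_equivalence : Equivalence Iso where
  refl L := ⟨LinearEquiv.refl ℤ L.carrier, fun _ _ => rfl⟩
  symm := by
    rintro L M ⟨e, he⟩
    exact ⟨e.symm, fun x y => by simpa using (he (e.symm x) (e.symm y)).symm⟩
  trans := by
    rintro L M K ⟨e, he⟩ ⟨f, hf⟩
    exact ⟨e.trans f, fun x y => by
      simpa only [LinearEquiv.trans_apply] using (hf (e x) (e y)).trans (he x y)⟩

/-- Isomorphism of Euclidean lattices, as an equivalence relation. -/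
def isoSetoid : Setoid EuclideanLattice := ⟨Iso, iso_equivalence⟩

/-- The isomorphism classes of Euclidean lattices. -/
def IsoClass : Type := Quotient isoSetoid

/-- The isomorphism class of a lattice. -/
def isoClass (L : EuclideanLattice) : IsoClass := Quotient.mk isoSetoid L

/-- The Gram matrix of a `ℤ`-basis of a lattice. -/
noncomputable def gramMatrix (L : EuclideanLattice) {ι : Type*}
    (b : Module.Basis ι ℤ L.carrier) : Matrix ι ι ℝ :=
  Matrix.of fun i j =>
    inner ℝ (b i : EuclideanSpace ℝ (Fin L.dim)) (b j : EuclideanSpace ℝ (Fin L.dim))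

theorem free (L : EuclideanLattice) : Module.Free ℤ L.carrier := ZLattice.module_free ℝ L.carrier

theorem finite (L : EuclideanLattice) : Module.Finite ℤ L.carrier :=
  ZLattice.module_finite ℝ L.carrier

open Classical in
/-- The determinant of a lattice: the determinant of the Gram matrix of a `ℤ`-basis.
By `det_gramMatrix` it does not depend on the basis. -/
noncomputable def det (L : EuclideanLattice) : ℝ :=
  haveI := L.free
  haveI := L.finite
  (L.gramMatrix (Module.Free.chooseBasis ℤ L.carrier)).det

theorem det_gramMatrix_eq (L : EuclideanLattice) {ι κ : Type*} [Fintype ι] [DecidableEq ι]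
    [Fintype κ] [DecidableEq κ] (b : Module.Basis ι ℤ L.carrier)
    (c : Module.Basis κ ℤ L.carrier) : (L.gramMatrix b).det = (L.gramMatrix c).det := by
  let e : κ ≃ ι := c.indexEquiv b
  let P : Matrix ι ι ℤ := b.toMatrix (c.reindex e)
  have hP : P.det ^ 2 = 1 := by
    have h : P * (c.reindex e).toMatrix b = 1 := b.toMatrix_mul_toMatrix_flip _
    have hu : IsUnit P.det := by
      have := congrArg Matrix.det h
      rw [Matrix.det_mul, Matrix.det_one] at this
      exact IsUnit.of_mul_eq_one _ this
    rcases Int.isUnit_iff.mp hu with h | h <;> simp [h]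
  have hG : L.gramMatrix (c.reindex e) =
      (P.map (Int.cast : ℤ → ℝ)).transpose * L.gramMatrix b * P.map (Int.cast : ℤ → ℝ) := by
    have hc : ∀ j, ((c.reindex e j : L.carrier) : EuclideanSpace ℝ (Fin L.dim)) =
        ∑ i, (P i j : ℝ) • (b i : EuclideanSpace ℝ (Fin L.dim)) := by
      intro j
      have := congrArg (Subtype.val) (b.sum_toMatrix_smul_self (c.reindex e) j)
      rw [← this, AddSubmonoidClass.coe_finsetSum]
      refine Finset.sum_congr rfl fun i _ => ?_
      rw [Int.cast_smul_eq_zsmul]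
      rfl
    ext i j
    simp only [gramMatrix, Matrix.of_apply, Matrix.mul_apply, Matrix.transpose_apply,
      Matrix.map_apply]
    rw [hc i, hc j, inner_sum]
    refine Finset.sum_congr rfl fun k _ => ?_
    rw [sum_inner, Finset.sum_mul]
    refine Finset.sum_congr rfl fun l _ => ?_
    rw [real_inner_smul_left, real_inner_smul_right]
    ring
  have hR : L.gramMatrix (c.reindex e) = (L.gramMatrix c).submatrix e.symm e.symm := by
    ext i j
    simp [gramMatrix]
  have hd : (P.map (Int.cast : ℤ → ℝ)).det ^ 2 = 1 := by
    have : (P.map (Int.cast : ℤ → ℝ)).det = (P.det : ℝ) := ((Int.castRingHom ℝ).map_det P).symm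
    rw [this]
    exact_mod_cast hP
  have h := congrArg Matrix.det hG
  rw [hR, Matrix.det_submatrix_equiv_self, Matrix.det_mul, Matrix.det_mul,
    Matrix.det_transpose] at h
  rw [h]
  linear_combination (-(L.gramMatrix b).det) * hd

theorem det_gramMatrix (L : EuclideanLattice) {ι : Type*} [Fintype ι] [DecidableEq ι]
    (b : Module.Basis ι ℤ L.carrier) : (L.gramMatrix b).det = L.det := by
  classical
  have := L.free
  have := L.finite
  exact L.det_gramMatrix_eq b _

/-- A lattice is of type T if it has a `ℤ`-basis with Gram matrix `T(α₁, …, α_d)` for some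
integers `α₁, …, α_d ≥ 2`. -/
def IsTypeT (L : EuclideanLattice) : Prop :=
  ∃ (d : ℕ) (α : Fin d → ℤ), (∀ i, 2 ≤ α i) ∧
    ∃ b : Module.Basis (Fin d) ℤ L.carrier,
      L.gramMatrix b = (tridiagonal α).map (Int.cast : ℤ → ℝ)

/-- The lattice has no vector of norm `1`, the norm of `x` being the scalar product of `x`
with itself. -/
def NoNormOne (L : EuclideanLattice) : Prop :=
  ∀ x ∈ L.carrier, inner ℝ x x ≠ (1 : ℝ)

end EuclideanLattice

/-!
A lattice of type T is given by a sequence `α` of integers `≥ 2`, and the count has two halves: the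
number of such sequences with `det T(α) = N` up to reversal, and the fact that two sequences give
isomorphic lattices exactly if they agree up to reversal.

*Sequences.* The determinants of `T(α₁, …, α_d)` and `T(α₂, …, α_d)` are the numerator and the
denominator of the continued fraction `α₁ - 1 / (α₂ - 1 / …)` (`det_tridiagonal`). Division with
remainder shows that the denominator, modulo `N`, gives a bijection from the sequences of
determinant `N` onto `(ℤ/N)ˣ` (`HJList.toUnit_bijective`). Writing the continued fraction as a
product of `2 × 2` matrices of determinant one shows that reversal of the sequence corresponds to
inversion of the unit (`HJList.toUnit_reverse`). Hence the number of sequences up to reversal is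
half of the number of units plus the number of units of order at most `2`.

*Lattices.* After alternating sign changes of the basis, a lattice vector becomes a height function
`Y` on `{0, …, n + 1}` that vanishes at both ends, and its norm is
`∑ (Y (k + 1) - Y k)² + ∑ (αₖ - 2) Yₖ²` (`dotProduct_tridiagonal_mulVec`). Call `v ≠ 0` irreducible
if the two summands in any nontrivial decomposition `v = y + z` have negative product. The
irreducible vectors are exactly `±` the indicator functions of intervals
(`irred_initial_sub_fin`, `exists_eq_initial_sub_of_irred`), which are the differences `pᵢ - pⱼ` of
`n + 1` vectors and form a copy of the root system `Aₙ`. An isometry preserves irreducibility, so up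
to sign it permutes the `pᵢ` modulo translation (`exists_perm_of_isometry`). The norm of `pᵢ - pⱼ`
is `2 + |tᵢ - tⱼ|` with `tⱼ = ∑_{k ≤ j} (αₖ - 2)` (`tForm_initial_sub`). A weakly increasing sequence
of points on the line is determined by its distances, up to translation and reflection, even when
the labels are permuted (`eq_add_or_eq_sub_rev_of_abs_sub_eq`). So `α` is determined up to reversal
(`eq_or_eq_comp_rev_of_isometry`).

The condition on vectors of norm `1` holds automatically: the increments of a height function sum to
zero, so the sum of their squares is even (`EuclideanLattice.IsTypeT.noNormOne`).
-/

/-! ### Hirzebruch–Jung continued fractions and units modulo `N` -/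

/-- The transfer matrix of one step of the Hirzebruch–Jung continued fraction
`a₁ - 1 / (a₂ - 1 / (a₃ - …))`. -/
def hjMatrix (a : ℤ) : Matrix (Fin 2) (Fin 2) ℤ := !![a, -1; 1, 0]

/-- The product of the transfer matrices of a list. Its first column holds the numerator and the
denominator of the continued fraction of the list; for a nonempty list, its second column holds the
negatives of those of the list without its last entry. -/
def hjProd (l : List ℤ) : Matrix (Fin 2) (Fin 2) ℤ := (l.map hjMatrix).prod

/-- The numerator of the Hirzebruch–Jung continued fraction of a list. It equals the determinant of
the tridiagonal matrix, see `det_tridiagonal`. -/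
def hjNum (l : List ℤ) : ℤ := hjProd l 0 0

/-- The denominator of the Hirzebruch–Jung continued fraction of a list, which is the numerator of the
tail; it is `0` for the empty list. -/
def hjDen (l : List ℤ) : ℤ := hjProd l 1 0

@[simp] theorem hjNum_nil : hjNum [] = 1 := by simp [hjNum, hjProd]

@[simp] theorem hjDen_nil : hjDen [] = 0 := by simp [hjDen, hjProd]

@[simp] theorem hjNum_cons (a : ℤ) (l : List ℤ) : hjNum (a :: l) = a * hjNum l - hjDen l := by
  simp [hjNum, hjDen, hjProd, hjMatrix, Matrix.mul_apply, Fin.sum_univ_two]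
  ring

@[simp] theorem hjDen_cons (a : ℤ) (l : List ℤ) : hjDen (a :: l) = hjNum l := by
  simp [hjNum, hjDen, hjProd, hjMatrix, Matrix.mul_apply, Fin.sum_univ_two]

theorem hjProd_det (l : List ℤ) : (hjProd l).det = 1 := by
  induction l with
  | nil => simp [hjProd]
  | cons a l ih =>
    rw [hjProd] at ih
    rw [hjProd, List.map_cons, List.prod_cons, Matrix.det_mul, ih]
    simp [hjMatrix, Matrix.det_fin_two]

/-- Reversal of the list amounts to transposition, up to conjugation by `diag (1, -1)`, because each
transfer matrix has this property. -/
theorem hjProd_reverse (l : List ℤ) :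
    hjProd l.reverse = !![1, 0; 0, -1] * (hjProd l).transpose * !![1, 0; 0, -1] := by
  induction l with
  | nil => ext i j; fin_cases i <;> fin_cases j <;> simp [hjProd, Matrix.mul_apply]
  | cons a l ih =>
    have h1 : hjProd (a :: l).reverse = hjProd l.reverse * hjMatrix a := by simp [hjProd]
    have h2 : hjProd (a :: l) = hjMatrix a * hjProd l := by simp [hjProd]
    have h3 : !![1, 0; 0, -1] * hjMatrix a = (hjMatrix a).transpose * !![1, 0; 0, -1] := by
      ext i j
      fin_cases i <;> fin_cases j <;> simp [hjMatrix, Matrix.mul_apply, Fin.sum_univ_two]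
    rw [h1, h2, ih, Matrix.mul_assoc, h3, Matrix.transpose_mul]
    simp only [Matrix.mul_assoc]

theorem hjNum_reverse (l : List ℤ) : hjNum l.reverse = hjNum l := by
  rw [hjNum, hjProd_reverse]
  simp [hjNum, Matrix.mul_apply, Matrix.vecMul, dotProduct, Fin.sum_univ_two]

theorem hjDen_reverse (l : List ℤ) : hjDen l.reverse = -hjProd l 0 1 := by
  rw [hjDen, hjProd_reverse]
  simp [Matrix.mul_apply, Matrix.vecMul, dotProduct, Fin.sum_univ_two]

/-- Modulo the numerator, the denominators of a list and of its reversal are inverse to each other: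
this is the statement that the product of the transfer matrices has determinant one. -/
theorem hjDen_mul_hjDen_reverse (l : List ℤ) :
    hjDen l * hjDen l.reverse = 1 - hjNum l * hjProd l 1 1 := by
  have h := hjProd_det l
  rw [Matrix.det_fin_two] at h
  rw [hjDen_reverse, hjDen, hjNum]
  linear_combination h

theorem hjDen_nonneg_and_lt {l : List ℤ} (hl : ∀ a ∈ l, 2 ≤ a) :
    0 ≤ hjDen l ∧ hjDen l < hjNum l := by
  induction l with
  | nil => simp
  | cons a l ih =>
    have h := ih fun b hb => hl b (List.mem_cons_of_mem _ hb)
    have ha := hl a List.mem_cons_self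
    rw [hjDen_cons, hjNum_cons]
    constructor
    · linarith
    · nlinarith

/-- A Hirzebruch–Jung continued fraction with entries at least `2` is determined by its value, as
each step is a division with remainder. -/
theorem eq_of_hjNum_eq_of_hjDen_eq {l l' : List ℤ} (hl : ∀ a ∈ l, 2 ≤ a) (hl' : ∀ a ∈ l', 2 ≤ a)
    (hn : hjNum l = hjNum l') (hd : hjDen l = hjDen l') : l = l' := by
  induction l generalizing l' with
  | nil =>
    cases l' with
    | nil => rfl
    | cons a t =>
      have h := hjDen_nonneg_and_lt fun b hb => hl' b (List.mem_cons_of_mem _ hb)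
      rw [hjDen_nil, hjDen_cons] at hd
      omega
  | cons a t ih =>
    have h := hjDen_nonneg_and_lt fun b hb => hl b (List.mem_cons_of_mem _ hb)
    cases l' with
    | nil =>
      rw [hjDen_nil, hjDen_cons] at hd
      omega
    | cons a' t' =>
      have h' := hjDen_nonneg_and_lt fun b hb => hl' b (List.mem_cons_of_mem _ hb)
      simp only [hjNum_cons, hjDen_cons] at hn hd
      rw [← hd] at hn h'
      have haa : a = a' := by
        rcases lt_trichotomy a a' with hlt | heq | hgt
        · nlinarith
        · exact heq
        · nlinarith
      subst haa
      rw [ih (fun b hb => hl b (List.mem_cons_of_mem _ hb))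
        (fun b hb => hl' b (List.mem_cons_of_mem _ hb)) hd (by linarith)]

theorem exists_hjNum_eq_hjDen_eq (n : ℤ) (m : ℕ) (hmn : (m : ℤ) < n)
    (hco : IsCoprime n (m : ℤ)) :
    ∃ l : List ℤ, (∀ a ∈ l, 2 ≤ a) ∧ hjNum l = n ∧ hjDen l = m := by
  induction m using Nat.strong_induction_on generalizing n with
  | _ m ih =>
    rcases Nat.eq_zero_or_pos m with rfl | hm
    · refine ⟨[], by simp, ?_, by simp⟩
      have := Int.isUnit_iff.mp (isCoprime_zero_right.mp (by simpa using hco))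
      rw [hjNum_nil]
      push_cast at hmn
      omega
    · -- the division `n = a * m - q` with `0 ≤ q < m`
      have hm' : (0 : ℤ) < m := by exact_mod_cast hm
      obtain ⟨q, hq⟩ := Int.eq_ofNat_of_zero_le (Int.emod_nonneg (-n) hm'.ne')
      have hqm : (q : ℤ) < m := hq ▸ Int.emod_lt_of_pos _ hm'
      have hdiv := Int.emod_add_mul_ediv (-n) m
      rw [hq] at hdiv
      set a : ℤ := -((-n) / (m : ℤ)) with ha
      have hn : n = a * m - q := by rw [ha]; linarith
      have hco' : IsCoprime (m : ℤ) (q : ℤ) := by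
        have h1 : IsCoprime (-(q : ℤ) + a * m) m := by
          rw [show -(q : ℤ) + a * m = n by rw [hn]; ring]
          exact hco
        exact (IsCoprime.neg_left_iff _ _ |>.mp
          ((IsCoprime.add_mul_right_left_iff).mp h1)).symm
      obtain ⟨l, hl, h1, h2⟩ := ih q (by exact_mod_cast hqm) m hqm hco'
      refine ⟨a :: l, ?_, ?_, ?_⟩
      · intro b hb
        rcases List.mem_cons.mp hb with rfl | hb
        · by_contra hcon
          nlinarith
        · exact hl b hb
      · rw [hjNum_cons, h1, h2, hn]
      · rw [hjDen_cons, h1]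

/-- The lists with entries at least `2` and continued fraction numerator `N`, that is, the sequences
`α` with all `αᵢ ≥ 2` and `det T(α) = N`. -/
def HJList (N : ℕ) : Type := {l : List ℤ // (∀ a ∈ l, 2 ≤ a) ∧ hjNum l = N}

namespace HJList

variable {N : ℕ}

/-- Reversal of a list, as an involution of `HJList N`. -/
def reverse (l : HJList N) : HJList N :=
  ⟨l.1.reverse, fun a ha => l.2.1 a (List.mem_reverse.mp ha), by rw [hjNum_reverse, l.2.2]⟩

theorem reverse_reverse (l : HJList N) : l.reverse.reverse = l :=
  Subtype.ext (List.reverse_reverse _)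

theorem den_mul_den_reverse (l : HJList N) :
    (hjDen l.1 : ZMod N) * (hjDen l.1.reverse : ZMod N) = 1 := by
  have h := congrArg (Int.cast : ℤ → ZMod N) (hjDen_mul_hjDen_reverse l.1)
  rw [l.2.2] at h
  simpa using h

/-- The denominator of the continued fraction, as a unit modulo the numerator `N`. -/
def toUnit (l : HJList N) : (ZMod N)ˣ where
  val := hjDen l.1
  inv := hjDen l.1.reverse
  val_inv := l.den_mul_den_reverse
  inv_val := by rw [mul_comm]; exact l.den_mul_den_reverse

theorem toUnit_reverse (l : HJList N) : l.reverse.toUnit = l.toUnit⁻¹ := by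
  ext
  rfl

theorem toUnit_bijective (hN : 2 ≤ N) : Function.Bijective (toUnit (N := N)) := by
  have : NeZero N := ⟨by omega⟩
  constructor
  · intro l l' h
    have h0 : ((hjDen l.1 : ℤ) : ZMod N) = (hjDen l'.1 : ℤ) := congrArg Units.val h
    rw [ZMod.intCast_eq_intCast_iff'] at h0
    have h1 := hjDen_nonneg_and_lt l.2.1
    have h2 := hjDen_nonneg_and_lt l'.2.1
    rw [l.2.2] at h1
    rw [l'.2.2] at h2
    rw [Int.emod_eq_of_lt h1.1 h1.2, Int.emod_eq_of_lt h2.1 h2.2] at h0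
    exact Subtype.ext (eq_of_hjNum_eq_of_hjDen_eq l.2.1 l'.2.1 (l.2.2.trans l'.2.2.symm) h0)
  · intro u
    have hco : IsCoprime (N : ℤ) ((u : ZMod N).val : ℤ) :=
      Nat.isCoprime_iff_coprime.mpr (ZMod.val_coe_unit_coprime u).symm
    obtain ⟨l, hl, h1, h2⟩ := exists_hjNum_eq_hjDen_eq N _
      (by exact_mod_cast ZMod.val_lt (u : ZMod N)) hco
    refine ⟨⟨l, hl, h1⟩, Units.ext ?_⟩
    change ((hjDen l : ℤ) : ZMod N) = u
    rw [h2]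
    simp

end HJList

/-! ### The determinant of a tridiagonal matrix -/

theorem tridiagonal_submatrix_succ {n : ℕ} (α : Fin (n + 1) → ℤ) :
    (tridiagonal α).submatrix Fin.succ Fin.succ = tridiagonal fun i => α i.succ := by
  ext i j
  simp [tridiagonal, Fin.succ_inj]

/-- The three-term recursion: expansion along the first row, then along the first column of the second
minor. -/
theorem det_tridiagonal_succ_succ {n : ℕ} (α : Fin (n + 2) → ℤ) :
    (tridiagonal α).det = α 0 * (tridiagonal fun i => α i.succ).det -
      (tridiagonal fun i => α i.succ.succ).det := by
  have hminor : ((tridiagonal α).submatrix Fin.succ (Fin.succAbove 1)).det =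
      (tridiagonal fun i => α i.succ.succ).det := by
    rw [Matrix.det_succ_column_zero, Fin.sum_univ_succ, Finset.sum_eq_zero]
    · have : ((tridiagonal α).submatrix Fin.succ (Fin.succAbove 1)).submatrix
          (Fin.succAbove 0) Fin.succ = tridiagonal fun i => α i.succ.succ := by
        ext i j
        have h1 : (Fin.succAbove (1 : Fin (n + 2)) j.succ) = j.succ.succ := by
          rw [← Fin.succ_zero_eq_one, Fin.succ_succAbove_succ, Fin.succAbove_zero]
        simp [tridiagonal, h1, Fin.succ_inj]
      rw [this]
      simp [tridiagonal]
    · intro i _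
      simp [tridiagonal, Fin.ext_iff]
  rw [Matrix.det_succ_row_zero, Fin.sum_univ_succ, Fin.sum_univ_succ, Finset.sum_eq_zero]
  · have h0 : (tridiagonal α).submatrix Fin.succ (Fin.succAbove 0) =
        tridiagonal fun i => α i.succ := by
      rw [Fin.succAbove_zero, tridiagonal_submatrix_succ]
    rw [h0, Fin.succ_zero_eq_one, hminor]
    simp [tridiagonal]
    ring
  · intro i _
    simp [tridiagonal, Fin.ext_iff]

theorem det_tridiagonal : ∀ {n : ℕ} (α : Fin n → ℤ),
    (tridiagonal α).det = hjNum (List.ofFn α)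
  | 0, α => by simp
  | 1, α => by simp [tridiagonal]
  | n + 2, α => by
    rw [det_tridiagonal_succ_succ, det_tridiagonal, det_tridiagonal]
    simp [List.ofFn_succ]

theorem tridiagonal_comp_rev {n : ℕ} (α : Fin n → ℤ) :
    tridiagonal (α ∘ Fin.rev) = (tridiagonal α).submatrix Fin.rev Fin.rev := by
  ext i j
  simp only [tridiagonal, Matrix.of_apply, Matrix.submatrix_apply, Fin.rev_inj, Fin.val_rev,
    Function.comp_apply]
  have hi := i.isLt
  have hj := j.isLt
  congr 1
  refine if_congr ?_ rfl rfl
  omega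

/-! ### The form `T(α)` in terms of height functions, and lattices with given Gram matrix -/

/-- The height function of a coordinate vector `y : Fin n → R`: the coordinates with alternating signs,
shifted by one and extended by zero, so that it vanishes at `0` and beyond `n`. The signs turn the
off-diagonal entries `1` of the tridiagonal matrix into `-1`. -/
def height {R : Type*} [CommRing R] {n : ℕ} (y : Fin n → R) : ℕ → R
  | 0 => 0
  | k + 1 => if h : k < n then (-1) ^ k * y ⟨k, h⟩ else 0

section height

variable {R : Type*} [CommRing R] {n : ℕ}

@[simp] theorem height_zero (y : Fin n → R) : height y 0 = 0 := rfl

theorem height_of_lt (y : Fin n → R) {k : ℕ} (hk : n < k) : height y k = 0 := by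
  cases k with
  | zero => rfl
  | succ k => simp [height, show ¬ k < n by omega]

theorem height_succ (y : Fin n → R) (k : Fin n) : height y (k + 1) = (-1) ^ (k : ℕ) * y k := by
  simp [height]

theorem neg_one_pow_mul_height (y : Fin n → R) (k : Fin n) :
    (-1) ^ (k : ℕ) * height y (k + 1) = y k := by
  rw [height_succ, ← mul_assoc, ← mul_pow]
  simp

theorem height_sub (y z : Fin n → R) (k : ℕ) : height (y - z) k = height y k - height z k := by
  cases k with
  | zero => simp
  | succ k => by_cases h : k < n <;> simp [height, h, mul_sub]

theorem height_neg (y : Fin n → R) (k : ℕ) : height (-y) k = -height y k := by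
  cases k with
  | zero => simp
  | succ k => by_cases h : k < n <;> simp [height, h]

theorem height_injective {y z : Fin n → R} (h : ∀ k ≤ n, height y k = height z k) : y = z := by
  ext k
  rw [← neg_one_pow_mul_height y, h _ k.isLt, neg_one_pow_mul_height]

/-- Summation by parts. -/
theorem sum_range_sub_mul_sub (Y Z : ℕ → R) (n : ℕ) :
    ∑ k ∈ Finset.range (n + 1), (Y (k + 1) - Y k) * (Z (k + 1) - Z k) =
      ∑ k ∈ Finset.range n, Y (k + 1) * (2 * Z (k + 1) - Z (k + 2) - Z k) +
        Y (n + 1) * (Z (n + 1) - Z n) - Y 0 * (Z 1 - Z 0) := by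
  induction n with
  | zero => simp; ring
  | succ n ih =>
    rw [Finset.sum_range_succ, ih, Finset.sum_range_succ _ n]
    ring

theorem tridiagonal_mulVec (α : Fin n → R) (z : Fin n → R) (i : Fin n) :
    (tridiagonal α).mulVec z i =
      (-1) ^ (i : ℕ) * (α i * height z (i + 1) - height z (i + 2) - height z i) := by
  have hz : ∀ j : Fin n, tridiagonal α i j * z j =
      (if j = i then α i * z i else 0) +
        (if (j : ℕ) = (i : ℕ) + 1 then (-1) ^ (j : ℕ) * height z (j + 1) else 0) +
        (if (j : ℕ) + 1 = (i : ℕ) then (-1) ^ (j : ℕ) * height z (j + 1) else 0) := by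
    intro j
    rw [neg_one_pow_mul_height]
    simp only [tridiagonal, Matrix.of_apply, Fin.ext_iff]
    by_cases h1 : (i : ℕ) = j
    · obtain rfl : i = j := Fin.ext h1
      simp
    · by_cases h2 : (j : ℕ) = (i : ℕ) + 1
      · simp [h2]
        intro h; omega
      · by_cases h3 : (j : ℕ) + 1 = (i : ℕ)
        · simp [← h3]; intro h; omega
        · simp [h1, h2, h3, eq_comm (a := (i : ℕ) + 1), eq_comm (a := (j : ℕ)) (b := (i : ℕ))]
  rw [Matrix.mulVec, dotProduct, Finset.sum_congr rfl fun j _ => hz j, Finset.sum_add_distrib,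
    Finset.sum_add_distrib, Finset.sum_ite_eq' Finset.univ i,
    Fin.sum_univ_eq_sum_range
      (fun j => if j = (i : ℕ) + 1 then (-1 : R) ^ j * height z (j + 1) else 0) n,
    Fin.sum_univ_eq_sum_range
      (fun j => if j + 1 = (i : ℕ) then (-1 : R) ^ j * height z (j + 1) else 0) n,
    Finset.sum_ite_eq' (Finset.range n)]
  have h2 : (if (i : ℕ) + 1 ∈ Finset.range n then
      (-1 : R) ^ ((i : ℕ) + 1) * height z (i + 1 + 1) else 0) =
      -((-1) ^ (i : ℕ) * height z (i + 2)) := by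
    split_ifs with h
    · ring
    · rw [height_of_lt z (by simp at h; omega)]
      simp
  have h3 : (∑ j ∈ Finset.range n, if j + 1 = (i : ℕ) then
      (-1 : R) ^ j * height z (j + 1) else 0) = -((-1) ^ (i : ℕ) * height z i) := by
    rcases Nat.eq_zero_or_pos (i : ℕ) with h0 | h0
    · simp [h0]
    · obtain ⟨m, hm⟩ : ∃ m, (i : ℕ) = m + 1 := ⟨i - 1, by omega⟩
      have hmn : m < n := by have := i.isLt; omega
      simp only [hm, Nat.add_right_cancel_iff]
      rw [Finset.sum_ite_eq', if_pos (Finset.mem_range.mpr hmn)]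
      ring
  rw [h2, h3, if_pos (Finset.mem_univ _), height_succ]
  have h1 : (-1 : R) ^ (i : ℕ) * (-1) ^ (i : ℕ) = 1 := by rw [← mul_pow]; simp
  linear_combination -(α i * z i) * h1

/-- The tridiagonal form is a sum of products of increments and of values of the height functions; for
`αᵢ ≥ 2` this exhibits it as positive semidefinite. -/
theorem dotProduct_tridiagonal_mulVec (α y z : Fin n → R) :
    y ⬝ᵥ (tridiagonal α).mulVec z =
      ∑ k ∈ Finset.range (n + 1),
          (height y (k + 1) - height y k) * (height z (k + 1) - height z k) +
        ∑ k : Fin n, (α k - 2) * (height y (k + 1) * height z (k + 1)) := by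
  rw [sum_range_sub_mul_sub, height_of_lt y (Nat.lt_succ_self n), height_zero,
    ← Fin.sum_univ_eq_sum_range
      (fun k => height y (k + 1) * (2 * height z (k + 1) - height z (k + 2) - height z k)) n,
    zero_mul, zero_mul, add_zero, sub_zero, ← Finset.sum_add_distrib, dotProduct]
  refine Finset.sum_congr rfl fun k _ => ?_
  rw [tridiagonal_mulVec, height_succ y]
  ring

end height

theorem posSemidef_tridiagonal {n : ℕ} {α : Fin n → ℝ} (hα : ∀ i, 2 ≤ α i) :
    (tridiagonal α).PosSemidef := by
  refine Matrix.PosSemidef.of_dotProduct_mulVec_nonneg ?_ fun x => ?_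
  · ext i j
    simp only [tridiagonal, Matrix.conjTranspose_apply, Matrix.of_apply, star_trivial,
      eq_comm (a := j), or_comm (a := (j : ℕ) + 1 = i)]
    split_ifs with h <;> simp_all
  · rw [star_trivial, dotProduct_tridiagonal_mulVec]
    refine add_nonneg (Finset.sum_nonneg fun k _ => mul_self_nonneg _)
      (Finset.sum_nonneg fun k _ => mul_nonneg (by linarith [hα k]) (mul_self_nonneg _))

theorem map_tridiagonal {R S : Type*} [CommRing R] [CommRing S] (f : R →+* S) {n : ℕ}
    (α : Fin n → R) : (tridiagonal α).map f = tridiagonal (f ∘ α) := by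
  ext i j
  simp only [tridiagonal, Matrix.map_apply, Matrix.of_apply, Function.comp_apply]
  split_ifs <;> simp

namespace EuclideanLattice

/-- A nonsingular positive semidefinite matrix `AᵀA` is the Gram matrix of the lattice spanned by the
columns of `A`. -/
theorem exists_gramMatrix_eq {n : ℕ} {G : Matrix (Fin n) (Fin n) ℝ} (hG : G.PosSemidef)
    (hdet : G.det ≠ 0) :
    ∃ (L : EuclideanLattice) (b : Module.Basis (Fin n) ℤ L.carrier), L.gramMatrix b = G := by
  open scoped MatrixOrder in
  obtain ⟨A, hA⟩ := CStarAlgebra.nonneg_iff_eq_star_mul_self.mp hG.nonneg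
  have hA' : G = A.transpose * A := by
    rw [hA, Matrix.star_eq_conjTranspose, Matrix.conjTranspose_eq_transpose_of_trivial]
  have hu : IsUnit A := by
    rw [Matrix.isUnit_iff_isUnit_det, isUnit_iff_ne_zero]
    rintro h
    rw [hA', Matrix.det_mul, h, mul_zero] at hdet
    exact hdet rfl
  let v : Fin n → EuclideanSpace ℝ (Fin n) := fun j => WithLp.toLp 2 (A.col j)
  have hv : LinearIndependent ℝ v := by
    have h := Matrix.linearIndependent_cols_of_isUnit hu
    exact h.map' (WithLp.linearEquiv 2 ℝ (Fin n → ℝ)).symm.toLinearMap (LinearEquiv.ker _)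
  let c := basisOfLinearIndependentOfCardEqFinrank' v hv (by simp)
  have hc : ∀ i, c i = v i := fun i => by simp [c]
  refine ⟨⟨n, Submodule.span ℤ (Set.range c)⟩, c.restrictScalars ℤ, ?_⟩
  ext i j
  simp only [gramMatrix, Matrix.of_apply]
  rw [Module.Basis.restrictScalars_apply, Module.Basis.restrictScalars_apply, hc, hc, hA']
  simp [v, Matrix.mul_apply, PiLp.inner_apply, mul_comm]

theorem inner_eq_dotProduct (L : EuclideanLattice) {ι : Type*} [Fintype ι]
    (b : Module.Basis ι ℤ L.carrier) (x y : L.carrier) :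
    inner ℝ (x : EuclideanSpace ℝ (Fin L.dim)) (y : EuclideanSpace ℝ (Fin L.dim)) =
      (fun i => (b.equivFun x i : ℝ)) ⬝ᵥ
        (L.gramMatrix b).mulVec fun i => (b.equivFun y i : ℝ) := by
  have hexp : ∀ z : L.carrier, (z : EuclideanSpace ℝ (Fin L.dim)) =
      ∑ i, (b.equivFun z i : ℝ) • (b i : EuclideanSpace ℝ (Fin L.dim)) := by
    intro z
    conv_lhs => rw [← b.sum_equivFun z]
    rw [AddSubmonoidClass.coe_finsetSum]
    refine Finset.sum_congr rfl fun i _ => ?_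
    rw [Int.cast_smul_eq_zsmul]
    rfl
  rw [hexp x, hexp y, sum_inner]
  refine Finset.sum_congr rfl fun i _ => ?_
  rw [inner_sum, Matrix.mulVec, dotProduct, Finset.mul_sum]
  refine Finset.sum_congr rfl fun j _ => ?_
  rw [real_inner_smul_left, real_inner_smul_right, gramMatrix, Matrix.of_apply]
  ring

theorem iso_of_gramMatrix_eq {L M : EuclideanLattice} {ι : Type*} [Fintype ι]
    (b : Module.Basis ι ℤ L.carrier) (c : Module.Basis ι ℤ M.carrier)
    (h : L.gramMatrix b = M.gramMatrix c) : L.Iso M := by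
  refine ⟨b.equivFun.trans c.equivFun.symm, fun x y => ?_⟩
  rw [M.inner_eq_dotProduct c, L.inner_eq_dotProduct b, h]
  simp only [LinearEquiv.trans_apply, LinearEquiv.apply_symm_apply]

theorem inner_eq_intCast {L : EuclideanLattice} {ι : Type*} [Fintype ι] {G : Matrix ι ι ℤ}
    {b : Module.Basis ι ℤ L.carrier} (h : L.gramMatrix b = G.map (Int.cast : ℤ → ℝ))
    (x y : L.carrier) :
    inner ℝ (x : EuclideanSpace ℝ (Fin L.dim)) (y : EuclideanSpace ℝ (Fin L.dim)) =
      ((b.equivFun x ⬝ᵥ G.mulVec (b.equivFun y) : ℤ) : ℝ) := by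
  rw [L.inner_eq_dotProduct b, h]
  simp [dotProduct, Matrix.mulVec]

end EuclideanLattice

/-! ### Irreducible vectors -/

/-- A nonzero vector `v` is irreducible for the form `B` if in every decomposition `v = y + (v - y)` into
two nonzero vectors the summands have negative product. The notion is invariant under isometries. -/
def Irred {V : Type*} [AddCommGroup V] (B : V → V → ℤ) (v : V) : Prop :=
  v ≠ 0 ∧ ∀ y, y ≠ 0 → y ≠ v → B y (v - y) < 0

/-- The bilinear form on `ℤⁿ` with matrix `T(α)`. -/
def tForm {n : ℕ} (α : Fin n → ℤ) (y z : Fin n → ℤ) : ℤ := y ⬝ᵥ (tridiagonal α).mulVec z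

/-- The vector of `ℤⁿ` whose height function is the indicator function of `{1, …, j}`. For
`0 ≤ i, j ≤ n` the differences `initial n j - initial n i` play the role of the roots of the
root system `Aₙ`. -/
def initial (n j : ℕ) : Fin n → ℤ := fun k => if (k : ℕ) < j then (-1) ^ (k : ℕ) else 0

/-- The sum of the `j` numbers `α₁ - 2, …, α_j - 2`. -/
def partialSum {n : ℕ} (α : Fin n → ℤ) (j : ℕ) : ℤ := ∑ k : Fin n, if (k : ℕ) < j then α k - 2 else 0

section

variable {n : ℕ}

theorem Irred.neg {α v : Fin n → ℤ} (h : Irred (tForm α) v) : Irred (tForm α) (-v) := by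
  refine ⟨neg_ne_zero.mpr h.1, fun y hy hyv => ?_⟩
  have := h.2 (-y) (neg_ne_zero.mpr hy) (fun h' => hyv (by rw [← h', neg_neg]))
  rwa [tForm, show v - -y = -(-v - y) by abel, Matrix.mulVec_neg, neg_dotProduct,
    dotProduct_neg, neg_neg] at this

theorem height_initial {j : ℕ} (hj : j ≤ n) (k : ℕ) :
    height (initial n j) k = if 0 < k ∧ k ≤ j then 1 else 0 := by
  cases k with
  | zero => simp
  | succ k =>
    by_cases h : k < n
    · by_cases h' : k < j
      · have : (-1 : ℤ) ^ k * (-1) ^ k = 1 := by rw [← mul_pow]; simp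
        simpa [height, initial, h, h', Nat.succ_le_iff] using this
      · simp [height, initial, h, h']
    · simp [height, h, show ¬ k + 1 ≤ j by omega]

theorem height_initial_sub {i j : ℕ} (hij : i ≤ j) (hj : j ≤ n) (k : ℕ) :
    height (initial n j - initial n i) k = if i < k ∧ k ≤ j then 1 else 0 := by
  rw [height_sub, height_initial hj, height_initial (hij.trans hj)]
  split_ifs <;> omega

theorem initial_sub_ne_zero {i j : ℕ} (hij : i < j) (hj : j ≤ n) :
    initial n j - initial n i ≠ 0 := by
  intro h
  have := height_initial_sub hij.le hj j
  rw [h, if_pos ⟨hij, le_rfl⟩, ← sub_self (0 : Fin n → ℤ), height_sub, sub_self] at this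
  exact zero_ne_one this

/-- Differences of initial vectors are irreducible. The increments and values of the height function of
such a difference `v` lie in `{-1, 0, 1}`, so every term of the form at `(y, v - y)` is nonpositive.
If all terms vanish, then `y` is `0` or `v`. -/
theorem irred_initial_sub {α : Fin n → ℤ} (hα : ∀ k, 2 ≤ α k) {i j : ℕ} (hij : i < j)
    (hj : j ≤ n) : Irred (tForm α) (initial n j - initial n i) := by
  refine ⟨initial_sub_ne_zero hij hj, fun y hy hyv => ?_⟩
  by_contra hcon
  push Not at hcon
  set v := initial n j - initial n i
  have hV : ∀ k, height v k = if i < k ∧ k ≤ j then 1 else 0 := height_initial_sub hij.le hj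
  clear_value v
  have hint : ∀ a b : ℤ, (a = 0 ∨ a = 1 ∨ a = -1) → b * (a - b) ≤ 0 := by
    rintro a b (rfl | rfl | rfl)
    · nlinarith [mul_self_nonneg b]
    · rcases le_or_gt b 0 with h | h <;> nlinarith
    · rcases le_or_gt 0 b with h | h <;> nlinarith
  have h1 : ∀ k ∈ Finset.range (n + 1), (height y (k + 1) - height y k) *
      (height (v - y) (k + 1) - height (v - y) k) ≤ 0 := by
    intro k _
    rw [height_sub, height_sub, show height v (k + 1) - height y (k + 1) -
      (height v k - height y k) = (height v (k + 1) - height v k) -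
        (height y (k + 1) - height y k) by ring]
    refine hint _ _ ?_
    rw [hV, hV]
    split_ifs <;> omega
  have h2 : ∀ k : Fin n, (α k - 2) * (height y (k + 1) * height (v - y) (k + 1)) ≤ 0 := by
    intro k
    rw [height_sub]
    refine mul_nonpos_of_nonneg_of_nonpos (by linarith [hα k]) (hint _ _ ?_)
    rw [hV]
    split_ifs <;> omega
  rw [tForm, dotProduct_tridiagonal_mulVec] at hcon
  have h3 := Finset.sum_nonpos h1
  have h4 := Finset.sum_nonpos fun (k : Fin n) (_ : k ∈ Finset.univ) => h2 k
  have h5 := (Finset.sum_eq_zero_iff_of_nonpos h1).mp (by linarith)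
  -- each step of `y` is either zero or the corresponding step of `v`
  have hstep : ∀ k ≤ n, height y (k + 1) = height y k ∨
      height y (k + 1) - height y k = height v (k + 1) - height v k := by
    intro k hk
    have h := h5 k (Finset.mem_range.mpr (by omega))
    rw [height_sub, height_sub] at h
    rcases mul_eq_zero.mp h with h | h
    · left; linarith
    · right; linarith
  have hflat : ∀ k ≤ n, k ≠ i → k ≠ j → height y (k + 1) = height y k := by
    intro k hk hki hkj
    rcases hstep k hk with h | h
    · exact h
    · rw [hV, hV] at h
      split_ifs at h <;> omega
  have hlow : ∀ k ≤ i, height y k = 0 := by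
    intro k
    induction k with
    | zero => simp
    | succ k ih =>
      intro hk
      rw [hflat k (by omega) (by omega) (by omega), ih (by omega)]
  have hmid : ∀ k, i + 1 ≤ k → k ≤ j → height y k = height y (i + 1) := by
    intro k hk
    induction k, hk using Nat.le_induction with
    | base => simp
    | succ k hk ih =>
      intro hkj
      rw [hflat k (by omega) (by omega) (by omega), ih (by omega)]
  have hhigh : ∀ k, j + 1 ≤ k → k ≤ n + 1 → height y k = height y (j + 1) := by
    intro k hk
    induction k, hk using Nat.le_induction with
    | base => simp
    | succ k hk ih =>
      intro hkj
      rw [hflat k (by omega) (by omega) (by omega), ih (by omega)]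
  have hend : height y (j + 1) = 0 := by
    rw [← hhigh (n + 1) (by omega) le_rfl, height_of_lt y (Nat.lt_succ_self n)]
  have hval : height y (i + 1) = 0 ∨ height y (i + 1) = 1 := by
    have h := hstep i (by omega)
    rw [hlow i le_rfl, hV, hV, if_pos (by omega), if_neg (by omega)] at h
    simpa using h
  rcases hval with h | h
  · refine hy (height_injective fun k hk => ?_)
    rw [← sub_self (0 : Fin n → ℤ), height_sub, sub_self]
    rcases le_or_gt k i with hk1 | hk1
    · exact hlow k hk1
    · rcases le_or_gt k j with hk2 | hk2
      · rw [hmid k hk1 hk2, h]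
      · rw [hhigh k hk2 (by omega), hend]
  · refine hyv (height_injective fun k hk => ?_)
    rw [hV]
    rcases le_or_gt k i with hk1 | hk1
    · rw [hlow k hk1, if_neg (by omega)]
    · rcases le_or_gt k j with hk2 | hk2
      · rw [hmid k hk1 hk2, h, if_pos (by omega)]
      · rw [hhigh k hk2 (by omega), hend, if_neg (by omega)]

/-- An irreducible vector whose height is positive somewhere is a difference of initial vectors: the
indicator vector of a maximal interval of positive height has nonnegative product with the rest. -/
theorem eq_initial_sub_of_irred_of_pos {α : Fin n → ℤ} (hα : ∀ k, 2 ≤ α k) {v : Fin n → ℤ}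
    (hv : Irred (tForm α) v) {m : ℕ} (hm : 0 < height v m) :
    ∃ i j, i < j ∧ j ≤ n ∧ v = initial n j - initial n i := by
  have hmn : m ≤ n := by
    by_contra h
    rw [height_of_lt v (by omega)] at hm
    exact hm.false
  obtain ⟨i, him, hi, hi'⟩ : ∃ i < m, height v i ≤ 0 ∧ ∀ k, i < k → k ≤ m → 0 < height v k := by
    refine ⟨Nat.findGreatest (fun k => height v k ≤ 0) m, ?_, ?_, fun k hk hkm => ?_⟩
    · have hle := Nat.findGreatest_le (P := fun k => height v k ≤ 0) m
      refine lt_of_le_of_ne hle fun h => ?_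
      have := Nat.findGreatest_spec (P := fun k => height v k ≤ 0) (Nat.zero_le m) (by simp)
      rw [h] at this
      omega
    · exact Nat.findGreatest_spec (P := fun k => height v k ≤ 0) (Nat.zero_le m) (by simp)
    · exact not_le.mp (Nat.findGreatest_is_greatest hk hkm)
  obtain ⟨j, hmj, hjn, hj, hj'⟩ : ∃ j, m ≤ j ∧ j ≤ n ∧ height v (j + 1) ≤ 0 ∧
      ∀ k, m ≤ k → k ≤ j → 0 < height v k := by
    -- the height is zero at `n + 1`, so the interval of positive height ends there at the latest
    have hex : ∃ d, height v (m + d + 1) ≤ 0 :=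
      ⟨n - m, by rw [height_of_lt v (by omega)]⟩
    refine ⟨m + Nat.find hex, by omega, ?_, Nat.find_spec hex, fun k hk hkj => ?_⟩
    · have := Nat.find_min' hex (m := n - m) (by rw [height_of_lt v (by omega)])
      omega
    · rcases hk.eq_or_lt with rfl | hk
      · exact hm
      · have := Nat.find_min hex (m := k - m - 1) (by omega)
        rw [show m + (k - m - 1) + 1 = k by omega] at this
        omega
  have hij : i < j := by omega
  have hpos : ∀ k, i < k → k ≤ j → 0 < height v k := fun k h1 h2 =>
    if h : k ≤ m then hi' k h1 h else hj' k (by omega) h2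
  refine ⟨i, j, hij, hjn, ?_⟩
  by_contra hne
  have hlt := hv.2 _ (initial_sub_ne_zero hij hjn) (Ne.symm hne)
  refine absurd hlt (not_lt.mpr ?_)
  set y := initial n j - initial n i
  have hY : ∀ k, height y k = if i < k ∧ k ≤ j then 1 else 0 := height_initial_sub hij.le hjn
  clear_value y
  rw [tForm, dotProduct_tridiagonal_mulVec]
  refine add_nonneg (Finset.sum_nonneg fun k hk => ?_) (Finset.sum_nonneg fun k _ =>
    mul_nonneg (by linarith [hα k]) ?_)
  · rw [height_sub, height_sub, hY, hY]
    by_cases hki : k = i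
    · subst hki
      rw [if_pos (by omega), if_neg (by omega)]
      have := hpos (k + 1) (by omega) (by omega)
      linarith
    · by_cases hkj : k = j
      · subst hkj
        rw [if_neg (by omega), if_pos (by omega)]
        have := hpos k (by omega) (by omega)
        linarith
      · split_ifs <;> omega
  · rw [height_sub, hY]
    split_ifs with h
    · have := hpos (k + 1) h.1 h.2
      linarith
    · simp

theorem exists_eq_initial_sub_of_irred {α : Fin n → ℤ} (hα : ∀ k, 2 ≤ α k) {v : Fin n → ℤ}
    (hv : Irred (tForm α) v) :
    ∃ i j : Fin (n + 1), i ≠ j ∧ v = initial n i - initial n j := by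
  obtain ⟨m, hm⟩ : ∃ m, height v m ≠ 0 := by
    by_contra! h
    refine hv.1 (height_injective fun k _ => ?_)
    rw [h, ← sub_self (0 : Fin n → ℤ), height_sub, sub_self]
  rcases hm.lt_or_gt with hm | hm
  · obtain ⟨i, j, hij, hj, h⟩ := eq_initial_sub_of_irred_of_pos hα hv.neg (m := m)
      (by rw [height_neg]; omega)
    refine ⟨⟨i, by omega⟩, ⟨j, by omega⟩, by simp [hij.ne], ?_⟩
    rw [← neg_neg v, h, neg_sub]
  · obtain ⟨i, j, hij, hj, h⟩ := eq_initial_sub_of_irred_of_pos hα hv hm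
    exact ⟨⟨j, by omega⟩, ⟨i, by omega⟩, by simp [hij.ne'], h⟩

theorem irred_initial_sub_fin {α : Fin n → ℤ} (hα : ∀ k, 2 ≤ α k) {i j : Fin (n + 1)}
    (hij : i ≠ j) : Irred (tForm α) (initial n i - initial n j) := by
  rcases lt_or_gt_of_ne hij with h | h
  · rw [← neg_sub]
    exact (irred_initial_sub hα h (by omega)).neg
  · exact irred_initial_sub hα h (by omega)

theorem partialSum_mono {α : Fin n → ℤ} (hα : ∀ k, 2 ≤ α k) : Monotone (partialSum α) := by
  intro i j hij
  refine Finset.sum_le_sum fun k _ => ?_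
  have := hα k
  split_ifs <;> omega

theorem partialSum_succ (α : Fin n → ℤ) (k : Fin n) :
    partialSum α (k + 1) = partialSum α k + (α k - 2) := by
  have h : ∀ l : Fin n, (if (l : ℕ) < k + 1 then α l - 2 else 0) =
      (if (l : ℕ) < k then α l - 2 else 0) + if l = k then α l - 2 else 0 := by
    intro l
    simp only [Fin.ext_iff]
    split_ifs <;> omega
  rw [partialSum, Finset.sum_congr rfl fun l _ => h l, Finset.sum_add_distrib]
  simp [partialSum]

theorem tForm_initial_sub_of_lt (α : Fin n → ℤ) {i j : ℕ} (hij : i < j) (hj : j ≤ n) :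
    tForm α (initial n j - initial n i) (initial n j - initial n i) =
      2 + (partialSum α j - partialSum α i) := by
  rw [tForm, dotProduct_tridiagonal_mulVec]
  congr 1
  · have h : ∀ k : ℕ, (height (initial n j - initial n i) (k + 1) -
        height (initial n j - initial n i) k) * (height (initial n j - initial n i) (k + 1) -
        height (initial n j - initial n i) k) =
        (if k = i then 1 else 0) + if k = j then 1 else 0 := by
      intro k
      rw [height_initial_sub hij.le hj, height_initial_sub hij.le hj]
      split_ifs <;> omega
    simp only [h, Finset.sum_add_distrib, Finset.sum_ite_eq', Finset.mem_range]
    rw [if_pos (by omega), if_pos (by omega)]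
    norm_num
  · rw [partialSum, partialSum, ← Finset.sum_sub_distrib]
    refine Finset.sum_congr rfl fun k _ => ?_
    rw [height_initial_sub hij.le hj]
    split_ifs <;> omega

/-- The norms of the differences of initial vectors are, up to the constant `2`, the distances of points
on the line. -/
theorem tForm_initial_sub {α : Fin n → ℤ} (hα : ∀ k, 2 ≤ α k) {i j : Fin (n + 1)}
    (hij : i ≠ j) :
    tForm α (initial n i - initial n j) (initial n i - initial n j) =
      2 + |partialSum α i - partialSum α j| := by
  rcases lt_or_gt_of_ne hij with h | h
  · rw [← neg_sub, tForm, Matrix.mulVec_neg, neg_dotProduct, dotProduct_neg, neg_neg, ← tForm,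
      tForm_initial_sub_of_lt α h (by omega), abs_sub_comm,
      abs_of_nonneg (sub_nonneg.mpr (partialSum_mono hα (le_of_lt h)))]
  · rw [tForm_initial_sub_of_lt α h (by omega),
      abs_of_nonneg (sub_nonneg.mpr (partialSum_mono hα (le_of_lt h)))]

end

/-! ### Isometries between tridiagonal forms -/

/-- Two weakly increasing finite sequences of points on the line whose distances agree up to a
permutation of the points differ by a translation or a reflection. -/
theorem eq_add_or_eq_sub_rev_of_abs_sub_eq {n : ℕ} {t t' : Fin (n + 1) → ℤ} (ht : Monotone t)
    (ht' : Monotone t') (σ : Equiv.Perm (Fin (n + 1)))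
    (h : ∀ i j, |t' (σ i) - t' (σ j)| = |t i - t j|) :
    (∃ c, ∀ i, t' i = c + t i) ∨ ∃ c, ∀ i, t' i = c - t i.rev := by
  have key : (∀ i, t' (σ i) = t' (σ 0) - t 0 + t i) ∨ ∀ i, t' (σ i) = t' (σ 0) + t 0 - t i := by
    -- every point lies between the extreme ones, whose images therefore decide the orientation
    have h0 := h (Fin.last n) 0
    have hle : t 0 ≤ t (Fin.last n) := ht (Fin.zero_le _)
    rw [abs_of_nonneg (sub_nonneg.mpr hle)] at h0
    have hi : ∀ i, |t' (σ i) - t' (σ 0)| = t i - t 0 ∧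
        |t' (σ (Fin.last n)) - t' (σ i)| = t (Fin.last n) - t i := fun i =>
      ⟨by rw [h, abs_of_nonneg (sub_nonneg.mpr (ht (Fin.zero_le _)))],
        by rw [h, abs_of_nonneg (sub_nonneg.mpr (ht (Fin.le_last _)))]⟩
    rcases le_total 0 (t' (σ (Fin.last n)) - t' (σ 0)) with hs | hs
    · left
      intro i
      obtain ⟨h1, h2⟩ := hi i
      rcases abs_cases (t' (σ i) - t' (σ 0)) with h3 | h3 <;>
        rcases abs_cases (t' (σ (Fin.last n)) - t' (σ i)) with h4 | h4 <;>
        rw [abs_of_nonneg hs] at h0 <;> omega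
    · right
      intro i
      obtain ⟨h1, h2⟩ := hi i
      rcases abs_cases (t' (σ i) - t' (σ 0)) with h3 | h3 <;>
        rcases abs_cases (t' (σ (Fin.last n)) - t' (σ i)) with h4 | h4 <;>
        rw [abs_of_nonpos hs] at h0 <;> omega
  rcases key with key | key
  · left
    refine ⟨t' (σ 0) - t 0, fun i => ?_⟩
    rw [← key]
    have hm : Monotone (t' ∘ σ) := fun i j hij => by
      simp only [Function.comp_apply]
      rw [key i, key j]
      linarith [ht hij]
    exact congrFun (Tuple.unique_monotone (σ := 1) (τ := σ) (f := t') ht' hm) i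
  · right
    refine ⟨t' (σ 0) + t 0, fun i => ?_⟩
    rw [← key]
    have hm : Monotone (t' ∘ (Fin.revPerm.trans σ : Equiv.Perm (Fin (n + 1)))) := fun i j hij => by
      have := ht (Fin.rev_le_rev.mpr hij)
      simp only [Function.comp_apply, Equiv.trans_apply, Fin.revPerm_apply]
      rw [key i.rev, key j.rev]
      linarith
    exact congrFun (Tuple.unique_monotone (σ := 1) (τ := Fin.revPerm.trans σ) (f := t')
      ht' hm) i

/-- Pairs any two of which share their first or share their second entry either all share the first or
all share the second. -/
theorem forall_eq_or_forall_eq_of_pairwise {ι κ : Type*} {A B : ι → κ}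
    (h : ∀ i j, A i = A j ∨ B i = B j) : (∀ i j, A i = A j) ∨ ∀ i j, B i = B j := by
  by_contra! hcon
  obtain ⟨⟨i, j, hij⟩, k, l, hkl⟩ := hcon
  have h1 := h i j
  have h2 := h k l
  have h3 := h i k
  have h4 := h i l
  have h5 := h j k
  have h6 := h j l
  grind

section

variable {n : ℕ}

/-- The decrement at `m` of the height function of an initial vector is the coefficient of `e_m` in
`e_j - e_0`. -/
theorem height_initial_sub_height_succ {j : ℕ} (hj : j ≤ n) (m : ℕ) :
    height (initial n j) m - height (initial n j) (m + 1) =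
      (if m = j then 1 else 0) - if m = 0 then 1 else 0 := by
  rw [height_initial hj, height_initial hj]
  split_ifs <;> omega

/-- If the difference of two roots `e_a - e_b` and `e_c - e_d` of `Aₙ` is again a root, then the two
roots share exactly one end, in the same role. -/
theorem eq_or_eq_of_initial_sub_sub {a b c d x y : Fin (n + 1)} (hab : a ≠ b) (hcd : c ≠ d)
    (hxy : x ≠ y)
    (h : initial n a - initial n b - (initial n c - initial n d) = initial n x - initial n y) :
    a = c ∧ b ≠ d ∨ b = d ∧ a ≠ c := by
  -- the coefficient of `e_m` on both sides
  have key : ∀ m : Fin (n + 1), ((if m = a then 1 else 0) - (if m = b then 1 else 0)) -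
      ((if m = c then 1 else 0) - (if m = d then 1 else 0)) =
      (if m = x then 1 else 0) - (if m = y then (1 : ℤ) else 0) := by
    intro m
    have e := fun j : Fin (n + 1) =>
      height_initial_sub_height_succ (n := n) (j := j) (by omega) m
    have h1 := congrArg (fun v => height v (m : ℕ)) h
    have h2 := congrArg (fun v => height v ((m : ℕ) + 1)) h
    simp only [height_sub] at h1 h2
    simp only [Fin.ext_iff]
    linarith [e a, e b, e c, e d, e x, e y]
  have kx := key x
  have ka := key a
  have kb := key b
  have kc := key c
  have kd := key d
  grind

theorem initial_zero : initial n 0 = 0 := by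
  ext k
  simp [initial]

theorem initial_injective {i j : Fin (n + 1)} (h : initial n i = initial n j) : i = j := by
  by_contra hne
  rcases lt_or_gt_of_ne hne with hlt | hlt
  · exact initial_sub_ne_zero hlt (by omega) (sub_eq_zero.mpr h.symm)
  · exact initial_sub_ne_zero hlt (by omega) (sub_eq_zero.mpr h)

/-- An isometry permutes the initial vectors up to a common translation and sign. It preserves
irreducible vectors, so the images of `initial n i - initial n 0` are roots with pairwise
differences roots. -/
theorem exists_perm_of_isometry {α α' : Fin n → ℤ} (hα : ∀ k, 2 ≤ α k) (hα' : ∀ k, 2 ≤ α' k)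
    (φ : (Fin n → ℤ) ≃ₗ[ℤ] (Fin n → ℤ)) (hφ : ∀ y z, tForm α' (φ y) (φ z) = tForm α y z) :
    ∃ σ : Equiv.Perm (Fin (n + 1)),
      (∀ i j : Fin (n + 1), φ (initial n i - initial n j) =
        initial n (σ i : Fin (n + 1)) - initial n (σ j : Fin (n + 1))) ∨
      (∀ i j : Fin (n + 1), φ (initial n i - initial n j) =
        initial n (σ j : Fin (n + 1)) - initial n (σ i : Fin (n + 1))) := by
  have hirr : ∀ v, Irred (tForm α) v → Irred (tForm α') (φ v) := by
    refine fun v hv => ⟨fun h => hv.1 (by simpa using h), fun y hy hyv => ?_⟩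
    have := hv.2 (φ.symm y) (by simpa using hy) (fun h => hyv (by rw [← h, φ.apply_symm_apply]))
    rw [← hφ, map_sub, φ.apply_symm_apply] at this
    exact this
  have hroot : ∀ i j : Fin (n + 1), i ≠ j →
      ∃ a b : Fin (n + 1), a ≠ b ∧ φ (initial n i - initial n j) = initial n a - initial n b :=
    fun i j hij => exists_eq_initial_sub_of_irred hα' (hirr _ (irred_initial_sub_fin hα hij))
  choose A B hAB hφAB using fun i : Fin n => hroot i.succ 0 (Fin.succ_ne_zero i)
  have h0 : initial n ((0 : Fin (n + 1)) : ℕ) = 0 := initial_zero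
  simp only [h0, sub_zero] at hφAB
  have hpair : ∀ i j, i ≠ j → A i = A j ∧ B i ≠ B j ∨ B i = B j ∧ A i ≠ A j := by
    intro i j hij
    obtain ⟨x, y, hxy, h⟩ := hroot i.succ j.succ (by simpa using hij)
    rw [map_sub, hφAB, hφAB] at h
    exact eq_or_eq_of_initial_sub_sub (hAB i) (hAB j) hxy h
  have hinj : ∀ σ : Fin (n + 1) → Fin (n + 1),
      ((∀ i j : Fin (n + 1), φ (initial n i - initial n j) = initial n (σ i) - initial n (σ j)) ∨
      (∀ i j : Fin (n + 1), φ (initial n i - initial n j) = initial n (σ j) - initial n (σ i))) →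
      Function.Injective σ := by
    intro σ h i j hij
    have h0 : φ (initial n i - initial n j) = 0 := by
      rcases h with h | h <;> rw [h, hij, sub_self]
    exact initial_injective (sub_eq_zero.mp (φ.map_eq_zero_iff.mp h0))
  suffices hσ : ∃ σ : Fin (n + 1) → Fin (n + 1),
      (∀ i j : Fin (n + 1), φ (initial n i - initial n j) = initial n (σ i) - initial n (σ j)) ∨
      (∀ i j : Fin (n + 1), φ (initial n i - initial n j) = initial n (σ j) - initial n (σ i)) by
    obtain ⟨σ, h⟩ := hσ
    exact ⟨Equiv.ofBijective σ (Finite.injective_iff_bijective.mp (hinj σ h)), h⟩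
  rcases n with _ | n
  · exact ⟨id, Or.inl fun i j => Subsingleton.elim _ _⟩
  rcases forall_eq_or_forall_eq_of_pairwise (A := A) (B := B)
    (fun i j => if h : i = j then Or.inl (congrArg A h)
      else (hpair i j h).imp And.left And.left) with hA | hB
  · refine ⟨Fin.cons (A 0) B, Or.inr fun i j => ?_⟩
    have : ∀ i : Fin (n + 2), φ (initial (n + 1) i) = initial (n + 1) (A 0) -
        initial (n + 1) ((Fin.cons (A 0) B : Fin (n + 2) → Fin (n + 2)) i) := by
      intro i
      cases i using Fin.cases with
      | zero => rw [h0, map_zero, Fin.cons_zero, sub_self]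
      | succ i => rw [hφAB, Fin.cons_succ, hA i 0]
    rw [map_sub, this, this]
    abel
  · refine ⟨Fin.cons (B 0) A, Or.inl fun i j => ?_⟩
    have : ∀ i : Fin (n + 2), φ (initial (n + 1) i) =
        initial (n + 1) ((Fin.cons (B 0) A : Fin (n + 2) → Fin (n + 2)) i) - initial (n + 1) (B 0) := by
      intro i
      cases i using Fin.cases with
      | zero => rw [h0, map_zero, Fin.cons_zero, sub_self]
      | succ i => rw [hφAB, Fin.cons_succ, hB i 0]
    rw [map_sub, this, this]
    abel

theorem eq_or_eq_comp_rev_of_isometry {α α' : Fin n → ℤ} (hα : ∀ k, 2 ≤ α k)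
    (hα' : ∀ k, 2 ≤ α' k) (φ : (Fin n → ℤ) ≃ₗ[ℤ] (Fin n → ℤ))
    (hφ : ∀ y z, tForm α' (φ y) (φ z) = tForm α y z) : α' = α ∨ α' = α ∘ Fin.rev := by
  obtain ⟨σ, hσ⟩ := exists_perm_of_isometry hα hα' φ hφ
  have hdist : ∀ i j, |partialSum α' (σ i : Fin (n + 1)) - partialSum α' (σ j : Fin (n + 1))| =
      |partialSum α (i : Fin (n + 1)) - partialSum α (j : Fin (n + 1))| := by
    intro i j
    by_cases hij : i = j
    · simp [hij]
    have h := hφ (initial n i - initial n j) (initial n i - initial n j)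
    have hne : σ i ≠ σ j := fun h => hij (σ.injective h)
    rw [tForm_initial_sub hα hij] at h
    rcases hσ with hσ | hσ
    · rw [hσ, tForm_initial_sub hα' hne] at h
      linarith
    · rw [hσ, tForm_initial_sub hα' hne.symm, abs_sub_comm] at h
      linarith
  have hmono : ∀ {α : Fin n → ℤ}, (∀ k, 2 ≤ α k) →
      Monotone fun i : Fin (n + 1) => partialSum α i :=
    fun hα i j hij => partialSum_mono hα hij
  rcases eq_add_or_eq_sub_rev_of_abs_sub_eq (hmono hα) (hmono hα') σ hdist with ⟨c, hc⟩ | ⟨c, hc⟩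
  · left
    ext k
    have h1 := hc k.castSucc
    have h2 := hc k.succ
    simp only [Fin.val_castSucc, Fin.val_succ] at h1 h2
    have h3 := partialSum_succ α k
    have h4 := partialSum_succ α' k
    linarith
  · right
    ext k
    have h1 := hc k.castSucc
    have h2 := hc k.succ
    rw [Fin.rev_castSucc] at h1
    rw [Fin.rev_succ] at h2
    simp only [Fin.val_castSucc, Fin.val_succ] at h1 h2
    have h3 := partialSum_succ α k.rev
    have h4 := partialSum_succ α' k
    rw [Function.comp_apply]
    linarith

end

theorem List.ofFn_comp_rev {β : Type*} {n : ℕ} (f : Fin n → β) :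
    List.ofFn (f ∘ Fin.rev) = (List.ofFn f).reverse := by
  refine List.ext_getElem (by simp) fun k h1 h2 => ?_
  simp only [List.getElem_ofFn, List.getElem_reverse, List.length_ofFn, Function.comp_apply]
  congr 1
  ext
  simp only [Fin.val_rev]
  omega

namespace EuclideanLattice

theorem ofFn_eq_or_eq_reverse_of_iso {L M : EuclideanLattice} (h : L.Iso M) {m n : ℕ}
    {α : Fin m → ℤ} {α' : Fin n → ℤ} (hα : ∀ k, 2 ≤ α k) (hα' : ∀ k, 2 ≤ α' k)
    {b : Module.Basis (Fin m) ℤ L.carrier} {c : Module.Basis (Fin n) ℤ M.carrier}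
    (hb : L.gramMatrix b = (tridiagonal α).map (Int.cast : ℤ → ℝ))
    (hc : M.gramMatrix c = (tridiagonal α').map (Int.cast : ℤ → ℝ)) :
    List.ofFn α' = List.ofFn α ∨ List.ofFn α' = (List.ofFn α).reverse := by
  obtain ⟨e, he⟩ := h
  obtain rfl : m = n := by simpa using Fintype.card_congr ((b.map e).indexEquiv c)
  have h := eq_or_eq_comp_rev_of_isometry hα hα'
    (b.equivFun.symm.trans (e.trans c.equivFun)) fun y z => by
      have h := he (b.equivFun.symm y) (b.equivFun.symm z)
      rw [inner_eq_intCast hb, inner_eq_intCast hc, b.equivFun.apply_symm_apply,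
        b.equivFun.apply_symm_apply] at h
      exact_mod_cast h
  refine h.imp (congrArg _) fun h => ?_
  rw [h]
  exact (List.ofFn_comp_rev α)

end EuclideanLattice

/-! ### The count of isomorphism classes -/

/-- If the fibers of `f` are the orbits of an involution, then twice the number of values of `f` is the
number of points plus the number of fixed points. -/
theorem card_eq_of_fibers_orbits {X Y : Type*} [Finite X] {f : X → Y} {i : X → X}
    (hi : ∀ x, i (i x) = x) (hf : ∀ x y, f x = f y ↔ y = x ∨ y = i x) :
    2 * Nat.card (Set.range f) = Nat.card X + Nat.card {x // i x = x} := by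
  classical
  have := Fintype.ofFinite X
  have hR : Nat.card (Set.range f) = (Finset.univ.image f).card := by
    rw [Nat.card_coe_set_eq, ← Set.ncard_coe_finset]
    simp
  have hF : Nat.card {x // i x = x} = (Finset.univ.filter fun x => i x = x).card := by
    rw [Nat.card_eq_fintype_card, Fintype.card_subtype]
  rw [hR, hF, Nat.card_eq_fintype_card, ← Finset.card_univ,
    Finset.card_eq_sum_card_image f Finset.univ,
    Finset.card_eq_sum_card_fiberwise (f := f) (t := Finset.univ.image f)
      (s := Finset.univ.filter fun x => i x = x) (fun x _ => by simp),
    ← Finset.sum_add_distrib, mul_comm, ← smul_eq_mul, ← Finset.sum_const]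
  refine Finset.sum_congr rfl fun y hy => ?_
  obtain ⟨x, -, rfl⟩ := Finset.mem_image.mp hy
  have hf' : ∀ z, f z = f x ↔ z = x ∨ z = i x := fun z => by rw [eq_comm, hf]
  have h1 : (Finset.univ.filter fun z => f z = f x) = {x, i x} := by
    ext z
    simp only [Finset.mem_filter, Finset.mem_univ, true_and, Finset.mem_insert,
      Finset.mem_singleton, hf']
  rw [Finset.filter_filter]
  by_cases hx : i x = x
  · have h2 : (Finset.univ.filter fun z => i z = z ∧ f z = f x) = {x} := by
      ext z
      simp only [Finset.mem_filter, Finset.mem_univ, true_and, Finset.mem_singleton,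
        hf', hx, or_self]
      exact ⟨And.right, fun h => ⟨h ▸ hx, h⟩⟩
    rw [h1, h2, hx]
    simp
  · have h2 : (Finset.univ.filter fun z => i z = z ∧ f z = f x) = ∅ := by
      ext z
      simp only [Finset.mem_filter, Finset.mem_univ, true_and, Finset.notMem_empty, iff_false,
        hf']
      rintro ⟨h3, rfl | rfl⟩
      · exact hx h3
      · rw [hi] at h3
        exact hx h3.symm
    rw [h1, h2, Finset.card_pair (Ne.symm hx)]
    simp

namespace EuclideanLattice

/-- Lattices of type T never contain vectors of norm one. -/
theorem IsTypeT.noNormOne {L : EuclideanLattice} (hL : L.IsTypeT) : L.NoNormOne := by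
  obtain ⟨n, α, hα, b, hb⟩ := hL
  intro x hx h
  have h' := inner_eq_intCast hb ⟨x, hx⟩ ⟨x, hx⟩
  rw [h, dotProduct_tridiagonal_mulVec] at h'
  set y := b.equivFun ⟨x, hx⟩
  have h1 : ∑ k ∈ Finset.range (n + 1),
      (height y (k + 1) - height y k) * (height y (k + 1) - height y k) +
      ∑ k : Fin n, (α k - 2) * (height y (k + 1) * height y (k + 1)) = 1 := by exact_mod_cast h'.symm
  -- the steps of the height function sum to zero, so their squares have an even sum
  have hev : Even (∑ k ∈ Finset.range (n + 1),
      (height y (k + 1) - height y k) * (height y (k + 1) - height y k)) := by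
    have h2 : ∑ k ∈ Finset.range (n + 1), (height y (k + 1) - height y k) = 0 := by
      rw [Finset.sum_range_sub, height_of_lt y (Nat.lt_succ_self n), height_zero, sub_zero]
    rw [← add_zero (∑ k ∈ Finset.range (n + 1), _), ← h2, ← Finset.sum_add_distrib]
    refine Finset.even_sum _ fun k _ => ?_
    rw [show ∀ a : ℤ, a * a + a = a * (a + 1) from fun a => by ring]
    exact Int.even_mul_succ_self _
  have h3 : 0 ≤ ∑ k ∈ Finset.range (n + 1),
      (height y (k + 1) - height y k) * (height y (k + 1) - height y k) :=
    Finset.sum_nonneg fun k _ => mul_self_nonneg _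
  have h4 : ∀ k : Fin n, 0 ≤ (α k - 2) * (height y (k + 1) * height y (k + 1)) := fun k =>
    mul_nonneg (by linarith [hα k]) (mul_self_nonneg _)
  have h5 := Finset.sum_nonneg fun k (_ : k ∈ (Finset.univ : Finset (Fin n))) => h4 k
  have h6 : ∑ k ∈ Finset.range (n + 1),
      (height y (k + 1) - height y k) * (height y (k + 1) - height y k) = 0 := by
    obtain ⟨r, hr⟩ := hev
    omega
  -- if all steps vanish then so does the height function
  have h7 : ∀ k ≤ n, height y k = 0 := by
    intro k
    induction k with
    | zero => simp
    | succ k ih =>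
      intro hk
      have := (Finset.sum_eq_zero_iff_of_nonneg fun k _ => mul_self_nonneg _).mp h6 k
        (Finset.mem_range.mpr (by omega))
      have := mul_self_eq_zero.mp this
      rw [ih (by omega)] at this
      linarith
  rw [h6, Finset.sum_eq_zero fun k _ => by rw [h7 _ k.isLt]; ring] at h1
  omega

theorem exists_lattice_of_list {l : List ℤ} (hl : ∀ a ∈ l, 2 ≤ a) :
    ∃ (L : EuclideanLattice) (n : ℕ) (α : Fin n → ℤ) (b : Module.Basis (Fin n) ℤ L.carrier),
      (∀ k, 2 ≤ α k) ∧ List.ofFn α = l ∧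
        L.gramMatrix b = (tridiagonal α).map (Int.cast : ℤ → ℝ) := by
  have hα : ∀ k, 2 ≤ l.get k := fun k => hl _ (List.get_mem l k)
  have hpos : 0 < (tridiagonal l.get).det := by
    rw [det_tridiagonal, List.ofFn_get]
    have := hjDen_nonneg_and_lt hl
    omega
  have hmap : (tridiagonal l.get).map (Int.cast : ℤ → ℝ) =
      tridiagonal ((Int.castRingHom ℝ) ∘ l.get) := map_tridiagonal (Int.castRingHom ℝ) _
  obtain ⟨L, b, hb⟩ := exists_gramMatrix_eq (G := (tridiagonal l.get).map (Int.cast : ℤ → ℝ))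
    (by
      rw [hmap]
      exact posSemidef_tridiagonal fun k => by
        rw [Function.comp_apply, eq_intCast]
        exact_mod_cast hα k)
    (by
      have := (Int.castRingHom ℝ).map_det (tridiagonal l.get)
      change _ = ((tridiagonal l.get).map (Int.cast : ℤ → ℝ)).det at this
      rw [← this, eq_intCast]
      exact_mod_cast hpos.ne')
  exact ⟨L, _, l.get, b, hα, List.ofFn_get l, hb⟩

theorem det_eq_hjNum {L : EuclideanLattice} {n : ℕ} {α : Fin n → ℤ}
    {b : Module.Basis (Fin n) ℤ L.carrier}
    (hb : L.gramMatrix b = (tridiagonal α).map (Int.cast : ℤ → ℝ)) :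
    L.det = (hjNum (List.ofFn α) : ℝ) := by
  rw [← L.det_gramMatrix b, hb, ← det_tridiagonal]
  exact ((Int.castRingHom ℝ).map_det (tridiagonal α)).symm

theorem iso_of_ofFn_eq_reverse {L M : EuclideanLattice} {m n : ℕ}
    {α : Fin m → ℤ} {α' : Fin n → ℤ}
    {b : Module.Basis (Fin m) ℤ L.carrier} {c : Module.Basis (Fin n) ℤ M.carrier}
    (hb : L.gramMatrix b = (tridiagonal α).map (Int.cast : ℤ → ℝ))
    (hc : M.gramMatrix c = (tridiagonal α').map (Int.cast : ℤ → ℝ))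
    (h : List.ofFn α' = List.ofFn α ∨ List.ofFn α' = (List.ofFn α).reverse) : L.Iso M := by
  obtain rfl : m = n := by rcases h with h | h <;> simpa using (congrArg List.length h).symm
  rcases h with h | h
  · rw [List.ofFn_injective h] at hc
    exact iso_of_gramMatrix_eq b c (hb.trans hc.symm)
  · rw [← List.ofFn_comp_rev] at h
    rw [List.ofFn_injective h, tridiagonal_comp_rev] at hc
    refine iso_of_gramMatrix_eq (b.reindex Fin.revPerm) c ?_
    have hr : L.gramMatrix (b.reindex Fin.revPerm) =
        (L.gramMatrix b).submatrix Fin.rev Fin.rev := by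
      ext i j
      simp [gramMatrix]
    rw [hr, hb, hc]
    rfl

end EuclideanLattice

theorem mainTheorem4 (N : ℕ) (hN : 2 ≤ N) :
    (Nat.card {c : EuclideanLattice.IsoClass //
        ∃ L : EuclideanLattice, L.isoClass = c ∧ L.IsTypeT ∧ L.det = (N : ℝ) ∧ L.NoNormOne} : ℚ) =
      ((Nat.totient N : ℚ) + (Nat.card {u : (ZMod N)ˣ // orderOf u ≤ 2} : ℚ)) / 2 := by
  have : NeZero N := ⟨by omega⟩
  let e : HJList N ≃ (ZMod N)ˣ := Equiv.ofBijective _ (HJList.toUnit_bijective hN)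
  have : Finite (HJList N) := Finite.of_equiv _ e.symm
  -- one lattice for each admissible sequence
  choose L n α b hα hofFn hgram using fun l : HJList N => EuclideanLattice.exists_lattice_of_list l.2.1
  have hfib : ∀ l l' : HJList N, (L l).isoClass = (L l').isoClass ↔ l' = l ∨ l' = l.reverse := by
    intro l l'
    have hval : (l' = l ∨ l' = l.reverse) ↔
        (List.ofFn (α l') = List.ofFn (α l) ∨
          List.ofFn (α l') = (List.ofFn (α l)).reverse) := by
      rw [hofFn, hofFn]
      exact or_congr Subtype.ext_iff Subtype.ext_iff
    rw [hval]
    exact ⟨fun h => EuclideanLattice.ofFn_eq_or_eq_reverse_of_iso (Quotient.exact h) (hα l) (hα l')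
        (hgram l) (hgram l'),
      fun h => Quotient.sound (EuclideanLattice.iso_of_ofFn_eq_reverse (hgram l) (hgram l') h)⟩
  have hcount := card_eq_of_fibers_orbits HJList.reverse_reverse hfib
  have hrange : ∀ c : EuclideanLattice.IsoClass, (∃ L : EuclideanLattice, L.isoClass = c ∧ L.IsTypeT ∧
      L.det = (N : ℝ) ∧ L.NoNormOne) ↔ c ∈ Set.range fun l => (L l).isoClass := by
    intro c
    constructor
    · rintro ⟨M, rfl, ⟨m, γ, hγ, d, hd⟩, hdet, -⟩
      rw [EuclideanLattice.det_eq_hjNum hd] at hdet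
      let l : HJList N := ⟨List.ofFn γ, by simpa [List.mem_ofFn] using hγ, by exact_mod_cast hdet⟩
      exact ⟨l, Quotient.sound (EuclideanLattice.iso_of_ofFn_eq_reverse (hgram l) hd (Or.inl (hofFn l).symm))⟩
    · rintro ⟨l, rfl⟩
      have hT : (L l).IsTypeT := ⟨n l, α l, hα l, b l, hgram l⟩
      refine ⟨L l, rfl, hT, ?_, hT.noNormOne⟩
      rw [EuclideanLattice.det_eq_hjNum (hgram l), hofFn, l.2.2]
      simp
  have hcard : Nat.card (HJList N) = Nat.totient N := by
    rw [Nat.card_congr e, Nat.card_eq_fintype_card, ZMod.card_units_eq_totient]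
  have hfix : Nat.card {l : HJList N // l.reverse = l} =
      Nat.card {u : (ZMod N)ˣ // orderOf u ≤ 2} := by
    refine Nat.card_congr (e.subtypeEquiv fun l => ?_)
    rw [← e.injective.eq_iff]
    change l.reverse.toUnit = l.toUnit ↔ orderOf l.toUnit ≤ 2
    rw [HJList.toUnit_reverse, inv_eq_iff_mul_eq_one, ← sq]
    constructor
    · exact fun h => orderOf_le_of_pow_eq_one two_pos h
    · intro h
      have hpos := orderOf_pos l.toUnit
      have h2 : orderOf l.toUnit ∣ 2 := by
        interval_cases orderOf l.toUnit <;> norm_num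
      exact orderOf_dvd_iff_pow_eq_one.mp h2
  rw [Nat.card_congr (Equiv.subtypeEquivRight hrange), eq_div_iff two_ne_zero, mul_comm]
  rw [hcard, hfix] at hcount
  exact_mod_cast hcount
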